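/- Let $X$ be a complex Banach space with a normalized $1$-unconditional basis $\{e_i\}_{i\in I}$, where $I$ is countable (finite or infinite); that is, $\|e_i\|=1$ for all $i$, every $x\in X$ has a unique, unconditionally convergent expansion $x=\sum_{i\in I}x_ie_i$, and $\|\sum_i\varepsilon_ia_ie_i\|=\|\sum_ia_ie_i\|$ for all finitely supported complex families $(a_i)$ and all $\varepsilon_i\in\mathbb C$ with $|\varepsilon_i|=1$. Suppose that $X$ is strictly monotone: $\|x+y\|>\|x\|$ whenever $x,y\in X$ have nonnegative real coordinates and $y\neq0$. Let $P:X\to X$ be a linear projection with $\|P\|=1$, and let $Y=PX$. An element $x\in Y$ is called hermitian in $Y$ if there is a hermitian projection from $Y$ onto $\operatorname{span}\{x\}$, where a bounded operator $T$ on $Y$ is hermitian if $f(Ty)\in\mathbb R$ for all $y\in Y$ and $f\in Y^*$ with $\|f\|=1$ and $f(y)=\|y\|$. The Hilbert components of $Y$ are the maximal linear subspaces of $Y$ consisting of hermitian elements of $Y$. Suppose that $Y$ has no nontrivial Hilbert components, i.e. no Hilbert component of dimension greater than $1$. Then there is a countable family $(f_j)_{j\in J}$ of continuous linear functionals on $X$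 such that, for every $j\in J$, at most two indices $i\in I$ satisfy $f_j(e_i)\neq0$, and $$Y=\bigcap_{j\in J}\ker f_j .$$ -/

import Mathlib

noncomputable section

namespace OneComplemented

section Hermitian

variable {E : Type*} [NormedAddCommGroup E] [NormedSpace ℂ E]

/-- `f` is a norming functional for `x`: `‖f‖ = 1` and `f x = ‖x‖`. -/
def IsNorming (f : StrongDual ℂ E) (x : E) : Prop :=
  ‖f‖ = 1 ∧ f x = (‖x‖ : ℂ)

/-- A bounded operator on a complex normed space is hermitian if its numerical range
is real: `f (T x) ∈ ℝ` whenever `f` is a norming functional for `x`. -/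
def IsHermitianOperator (T : E →L[ℂ] E) : Prop :=
  ∀ (x : E) (f : StrongDual ℂ E), IsNorming f x → (f (T x)).im = 0

/-- `x` is a hermitian element of `E`: there is a hermitian projection from `E` onto
`span {x}`. -/
def IsHermitianElement (x : E) : Prop :=
  ∃ Q : E →L[ℂ] E, Q ∘L Q = Q ∧ (Q : E →ₗ[ℂ] E).range = Submodule.span ℂ {x} ∧
    IsHermitianOperator Q

variable (E) in
/-- The set `h(E)` of hermitian elements of `E`. -/
def hermitianElements : Set E := {x | IsHermitianElement x}

/-- A Hilbert component of `E` is a maximal linear subspace of `E` contained in `h(E)`. -/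
def IsHilbertComponent (H : Submodule ℂ E) : Prop :=
  Maximal (fun K : Submodule ℂ E => (K : Set E) ⊆ hermitianElements E) H

variable (E) in
/-- `E` has no nontrivial Hilbert components, that is, none of dimension greater than one. -/
def HasNoNontrivialHilbertComponent : Prop :=
  ∀ H : Submodule ℂ E, IsHilbertComponent H → ¬ 1 < Module.rank ℂ H

end Hermitian

section Basis

variable {ι X : Type*} [NormedAddCommGroup X] [NormedSpace ℂ X]

/-- The (complex) basis `b` is normalized and `1`-unconditional: multiplying coefficients by
unimodular scalars does not change the norm. -/
structure IsNormalizedOneUnconditional (b : UnconditionalSchauderBasis ι ℂ X) : Prop where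
  norm_basis : ∀ i, ‖b i‖ = 1
  norm_sum_eq : ∀ (s : Finset ι) (a ε : ι → ℂ), (∀ i, ‖ε i‖ = 1) →
    ‖∑ i ∈ s, (ε i * a i) • b i‖ = ‖∑ i ∈ s, a i • b i‖

/-- `x ≥ 0`: all coordinates of `x` are nonnegative real numbers. -/
def IsNonneg (b : UnconditionalSchauderBasis ι ℂ X) (x : X) : Prop :=
  ∀ i, 0 ≤ (b.coord i x).re ∧ (b.coord i x).im = 0

/-- Strict monotonicity: `‖x + y‖ > ‖x‖` for all `x, y ≥ 0` with `y ≠ 0`. -/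
def IsStrictlyMonotone (b : UnconditionalSchauderBasis ι ℂ X) : Prop :=
  ∀ x y : X, IsNonneg b x → IsNonneg b y → y ≠ 0 → ‖x‖ < ‖x + y‖

/-- The support of a functional: the indices of the basis vectors on which it does not vanish. -/
def functionalSupport (b : UnconditionalSchauderBasis ι ℂ X) (f : StrongDual ℂ X) : Set ι :=
  {i | f (b i) ≠ 0}

end Basis

end OneComplemented

end

/-!
Write `eᵢ` for the basis and `uᵢ = P eᵢ`. Rotating one coordinate is an isometry of `X`, so the
coordinate projection `x ↦ xᵢ eᵢ` is hermitian, and its compression `Tᵢ : y ↦ yᵢ uᵢ` to `Y` is a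
hermitian operator of rank at most one (`isHermitianOperator_compression`). A nonzero hermitian
operator does not have square zero, and strict monotonicity excludes `uᵢ = 0` when the `i`-th
coordinate does not vanish on `Y` (`coord_proj_basis_ne_zero`). For these `i`, then, `(uᵢ)ᵢ ≠ 0` and
`Tᵢ` is a multiple of a hermitian projection onto `span {uᵢ}`.

The main point is that two rank one hermitian projections with distinct ranges that are not mutually
orthogonal produce a plane of hermitian elements (`isHermitianElement_of_pair`), which Zorn's lemma
enlarges to a Hilbert component of dimension at least two. If `T` is a hermitian projection,
then `1 + (z - 1) T` is an isometry for `|z| = 1` (`IsHermitianOperator.norm_add_smul`).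
Conjugating the second projection by the isometries coming from the first, and taking real linear
combinations, gives for each vector of the plane a rank one hermitian operator with range spanned by it.

In the absence of nontrivial Hilbert components, `uᵢ` and `uⱼ` are therefore proportional as soon as
`(uⱼ)ᵢ ≠ 0`, for `i` and `j` such that the corresponding coordinates do not vanish on `Y`.
Since every `y ∈ Y` equals `∑ yᵢ uᵢ`, this makes `Y` the closed span of disjointly supported
vectors. Such a space is cut out by the relations `xᵢ = 0` outside the supports and by linear
relations between two coordinates inside one support (`cuttingFunctional`). Conversely, for a vector
`x` satisfying these relations, the identity `P x = x` is checked coordinatewise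
(`mem_of_cuttingFunctional_eq_zero`).
-/

namespace OneComplemented

open Filter Topology ComplexConjugate

/-! ### Hermitian operators and isometries -/

section HermitianOperators

variable {E : Type*} [NormedAddCommGroup E] [NormedSpace ℂ E]

/-- It suffices to bound the norm of `f` by one: if `f x = ‖x‖` and `x ≠ 0`, then `‖f‖ = 1`, and for
`x = 0` there is nothing to prove. -/
theorem IsHermitianOperator.im_eq_zero {T : E →L[ℂ] E} (hT : IsHermitianOperator T)
    {f : StrongDual ℂ E} {x : E} (hf : ‖f‖ ≤ 1) (hx : f x = (‖x‖ : ℂ)) : (f (T x)).im = 0 := by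
  rcases eq_or_ne x 0 with rfl | h0
  · simp
  · refine hT x f ⟨le_antisymm hf ?_, hx⟩
    have h := f.le_opNorm x
    rw [hx, Complex.norm_real, norm_norm] at h
    have : 0 < ‖x‖ := norm_pos_iff.2 h0
    nlinarith

theorem IsHermitianOperator.add {S T : E →L[ℂ] E} (hS : IsHermitianOperator S)
    (hT : IsHermitianOperator T) : IsHermitianOperator (S + T) := by
  intro x f hf
  simp [hS x f hf, hT x f hf]

theorem IsHermitianOperator.real_smul {T : E →L[ℂ] E} (hT : IsHermitianOperator T) (r : ℝ) :
    IsHermitianOperator ((r : ℂ) • T) := by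
  intro x f hf
  simp [hT x f hf]

theorem isHermitianOperator_id : IsHermitianOperator (ContinuousLinearMap.id ℂ E) := by
  intro x f hf
  simp [hf.2]

theorem IsHermitianOperator.sub {S T : E →L[ℂ] E} (hS : IsHermitianOperator S)
    (hT : IsHermitianOperator T) : IsHermitianOperator (S - T) := by
  intro x f hf
  simp [hS x f hf, hT x f hf]

theorem IsHermitianOperator.eigenvalue_im {T : E →L[ℂ] E} (hT : IsHermitianOperator T)
    {x : E} (hx : x ≠ 0) {c : ℂ} (h : T x = c • x) : c.im = 0 := by
  obtain ⟨f, hf, hfx⟩ := exists_dual_vector ℂ x (norm_ne_zero_iff.2 hx)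
  have h1 := hT x f ⟨hf, hfx⟩
  rw [h, map_smul, hfx] at h1
  simpa [hx] using h1

/-- For a norming functional `f` of `x` the number `f (i t T x)` is purely imaginary, hence
`‖x‖ = Re (f (x + i t T x))`. -/
theorem IsHermitianOperator.norm_le_norm_add {T : E →L[ℂ] E} (hT : IsHermitianOperator T)
    (t : ℝ) (x : E) : ‖x‖ ≤ ‖x + (t * Complex.I) • T x‖ := by
  obtain ⟨f, hf, hfx⟩ := exists_dual_vector'' ℂ x
  have h1 := hT.im_eq_zero hf hfx
  have h2 : ‖x‖ = (f (x + (t * Complex.I) • T x)).re := by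
    rw [map_add, map_smul, hfx]
    simp [h1]
  rw [h2]
  exact (Complex.re_le_norm _).trans (f.le_of_opNorm_le hf _ |>.trans (one_mul _).le)

/-- `x = (1 + i t T) (x - i t T x)` bounds `x - i t T x` independently of `t`. -/
theorem IsHermitianOperator.apply_eq_zero {T : E →L[ℂ] E} (hT : IsHermitianOperator T)
    {x : E} (h : T (T x) = 0) : T x = 0 := by
  have key : ∀ t : ℝ, |t| * ‖T x‖ ≤ 2 * ‖x‖ := by
    intro t
    have h1 := hT.norm_le_norm_add t (x - (t * Complex.I) • T x)
    rw [map_sub, map_smul, h, smul_zero, sub_zero, sub_add_cancel] at h1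
    have h2 := norm_sub_norm_le ((t * Complex.I) • T x) x
    rw [norm_sub_rev, norm_smul] at h2
    simp only [norm_mul, Complex.norm_real, Complex.norm_I, mul_one, Real.norm_eq_abs] at h2
    linarith
  by_contra h0
  have hpos : 0 < ‖T x‖ := norm_pos_iff.2 h0
  have h3 := key ((2 * ‖x‖ + 1) / ‖T x‖)
  rw [abs_of_nonneg (by positivity), div_mul_cancel₀ _ hpos.ne'] at h3
  linarith

/-- The operator `1 + (z - 1) T` is multiplicative in `z` when `T` is a projection. For
`z = 1 + i t` it does not decrease norms, and `exp (i s) = lim (1 + i s / n) ^ n`. -/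
theorem IsHermitianOperator.norm_le_norm_add_of_norm_eq_one {T : E →L[ℂ] E}
    (hT : IsHermitianOperator T) (hTT : ∀ x, T (T x) = T x) {z : ℂ} (hz : ‖z‖ = 1) (x : E) :
    ‖x‖ ≤ ‖x + (z - 1) • T x‖ := by
  have hpow : ∀ (t : ℝ) (n : ℕ), ‖x‖ ≤ ‖x + ((1 + t * Complex.I) ^ n - 1) • T x‖ := by
    intro t n
    induction n with
    | zero => simp
    | succ n ih =>
      refine ih.trans ((hT.norm_le_norm_add t _).trans_eq ?_)
      congr 1
      rw [map_add, map_smul, hTT]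
      module
  have hexp : Complex.exp (z.arg * Complex.I) = z := by
    simpa [hz] using Complex.norm_mul_exp_arg_mul_I z
  have hlim := Complex.tendsto_one_add_div_pow_exp (z.arg * Complex.I)
  rw [hexp] at hlim
  have hlim' := (((hlim.sub_const 1).smul_const (T x)).const_add x).norm
  refine ge_of_tendsto' hlim' fun n => ?_
  have := hpow (z.arg / n) n
  rwa [show ((z.arg / n : ℝ) : ℂ) * Complex.I = z.arg * Complex.I / n by push_cast; ring] at this

/-- For a projection `T` and `|z| = 1`, the operators `1 + (z - 1) T` and `1 + (conj z - 1) T` are mutually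
inverse. -/
theorem add_smul_add_smul_conj {T : E →L[ℂ] E}
    (hTT : ∀ x, T (T x) = T x) {z : ℂ} (hz : ‖z‖ = 1) (x : E) :
    (x + (conj z - 1) • T x) + (z - 1) • T (x + (conj z - 1) • T x) = x := by
  have hzz : z * conj z = 1 := by
    rw [Complex.mul_conj, Complex.normSq_eq_norm_sq, hz]; simp
  rw [map_add, map_smul, hTT]
  have : (x + (conj z - 1) • T x) + (z - 1) • (T x + (conj z - 1) • T x)
      = x + (z * conj z - 1) • T x := by module
  rw [this, hzz, sub_self, zero_smul, add_zero]

theorem IsHermitianOperator.norm_add_smul {T : E →L[ℂ] E}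
    (hT : IsHermitianOperator T) (hTT : ∀ x, T (T x) = T x) {z : ℂ} (hz : ‖z‖ = 1) (x : E) :
    ‖x + (z - 1) • T x‖ = ‖x‖ := by
  refine le_antisymm ?_ (hT.norm_le_norm_add_of_norm_eq_one hTT hz x)
  have hz' : ‖conj z‖ = 1 := by rwa [RCLike.norm_conj]
  have h := hT.norm_le_norm_add_of_norm_eq_one hTT hz' (x + (z - 1) • T x)
  have h2 := add_smul_add_smul_conj hTT hz' x
  rw [Complex.conj_conj] at h2
  rwa [h2] at h

/-- Conjugation by the isometry `1 + (z - 1) T` attached to a hermitian projection `T` preserves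
hermitian operators. -/
theorem IsHermitianOperator.conj_projection {S T : E →L[ℂ] E}
    (hS : IsHermitianOperator S) (hT : IsHermitianOperator T) (hTT : ∀ x, T (T x) = T x)
    {z : ℂ} (hz : ‖z‖ = 1) :
    IsHermitianOperator ((ContinuousLinearMap.id ℂ E + (z - 1) • T) ∘L S ∘L
      (ContinuousLinearMap.id ℂ E + (conj z - 1) • T)) := by
  intro x f hf
  have hz' : ‖conj z‖ = 1 := by rwa [RCLike.norm_conj]
  have h := hS.im_eq_zero (f := f ∘L (ContinuousLinearMap.id ℂ E + (z - 1) • T))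
    (x := x + (conj z - 1) • T x) ?_ ?_
  · exact h
  · refine ContinuousLinearMap.opNorm_le_bound _ zero_le_one fun y => ?_
    refine (f.le_of_opNorm_le hf.1.le _).trans ?_
    have := hT.norm_add_smul hTT hz y
    simp [this]
  · rw [hT.norm_add_smul hTT hz', ← hf.2]
    have := add_smul_add_smul_conj hTT hz x
    exact congrArg f this

end HermitianOperators

/-! ### Rank one hermitian operators and Hilbert components -/

section HermitianElements

variable {E : Type*} [NormedAddCommGroup E] [NormedSpace ℂ E]

theorem isHermitianElement_zero : IsHermitianElement (0 : E) := by
  refine ⟨0, by simp, by simp, fun x f _ => by simp⟩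

theorem IsHermitianOperator.coeff_im {φ : StrongDual ℂ E} {u : E}
    (h : IsHermitianOperator (φ.smulRight u)) : (φ u).im = 0 := by
  rcases eq_or_ne u 0 with rfl | h0
  · simp
  · exact h.eigenvalue_im h0 (by simp)

theorem IsHermitianOperator.normalize {φ : StrongDual ℂ E} {u : E}
    (h : IsHermitianOperator (φ.smulRight u)) :
    IsHermitianOperator (((φ u)⁻¹ • φ).smulRight u) := by
  have him : ((φ u).re : ℂ) = φ u := Complex.ext (by simp) (by simp [h.coeff_im])
  have h2 := h.real_smul (φ u).re⁻¹
  convert h2 using 1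
  ext x
  simp [him, smul_smul]

theorem IsHermitianOperator.isHermitianElement {φ : StrongDual ℂ E} {u : E}
    (h : IsHermitianOperator (φ.smulRight u)) (hu : φ u ≠ 0) : IsHermitianElement u := by
  refine ⟨((φ u)⁻¹ • φ).smulRight u, ?_, ?_, h.normalize⟩
  · ext x
    simp [hu]
  · apply le_antisymm
    · rintro _ ⟨x, rfl⟩
      exact Submodule.smul_mem _ _ (Submodule.mem_span_singleton_self u)
    · rw [Submodule.span_singleton_le_iff_mem]
      exact ⟨u, by simp [hu]⟩

/-- A rank one hermitian operator whose square vanishes is zero. -/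
theorem IsHermitianOperator.coeff_ne_zero {φ : StrongDual ℂ E} {u : E}
    (h : IsHermitianOperator (φ.smulRight u)) (hφ : φ ≠ 0) (hu : u ≠ 0) : φ u ≠ 0 := by
  intro h0
  obtain ⟨x, hx⟩ : ∃ x, φ x ≠ 0 := by
    by_contra! hcon
    exact hφ (ContinuousLinearMap.ext hcon)
  have := h.apply_eq_zero (x := x) (by simp [h0])
  simp [hx, hu] at this

variable {φ₁ φ₂ : StrongDual ℂ E} {u₁ u₂ : E}

/-- The number `φ₁ u₂ * φ₂ u₁` is the square of an eigenvalue of the hermitian operator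
`T₁ + T₂ - 1` on the plane spanned by `u₁` and `u₂`, where `Tₖ = φₖ(·) uₖ`. It vanishes only if
this operator is nilpotent on the plane. -/
theorem coeff_mul_coeff_pos (h₁ : IsHermitianOperator (φ₁.smulRight u₁))
    (h₂ : IsHermitianOperator (φ₂.smulRight u₂)) (e₁ : φ₁ u₁ = 1) (e₂ : φ₂ u₂ = 1)
    (hu : LinearIndependent ℂ ![u₁, u₂]) (hg : φ₁ u₂ ≠ 0) :
    ∃ c : ℝ, 0 < c ∧ φ₁ u₂ * φ₂ u₁ = c := by
  rw [LinearIndependent.pair_iff] at hu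
  have hN := (h₁.add h₂).sub isHermitianOperator_id
  obtain ⟨s, hs⟩ := IsAlgClosed.exists_eq_mul_self (φ₁ u₂ * φ₂ u₁)
  have hv : φ₁ u₂ • u₁ + s • u₂ ≠ 0 := fun h => hg (hu _ _ h).1
  have hsim : s.im = 0 := by
    refine hN.eigenvalue_im hv ?_
    simp only [_root_.sub_apply, _root_.add_apply,
      ContinuousLinearMap.smulRight_apply, ContinuousLinearMap.id_apply, map_add, map_smul,
      e₁, e₂]
    have : φ₁ u₂ • ((1 : ℂ) • u₁ + φ₂ u₁ • u₂ - u₁) + s • (φ₁ u₂ • u₁ + (1 : ℂ) • u₂ - u₂)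
      = (s * φ₁ u₂) • u₁ + (φ₁ u₂ * φ₂ u₁) • u₂ := by module
    rw [this, hs]
    module
  have hsre : (s.re : ℂ) = s := Complex.ext (by simp) (by simp [hsim])
  refine ⟨s.re * s.re, mul_self_pos.2 fun h0 => ?_, by rw [hs]; push_cast; rw [hsre]⟩
  have hs0 : s = 0 := by rw [← hsre, h0]; simp
  rw [hs0, mul_zero] at hs
  have hh : φ₂ u₁ = 0 := (mul_eq_zero.1 hs).resolve_left hg
  have := hN.apply_eq_zero (x := u₂) (by simp [e₁, e₂, hh])
  simp only [_root_.sub_apply, _root_.add_apply,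
      ContinuousLinearMap.smulRight_apply, ContinuousLinearMap.id_apply, e₂, one_smul,
      add_sub_cancel_right] at this
  exact hg (hu (φ₁ u₂) 0 (by simpa using this)).1

/-- Otherwise the square of the hermitian operator `T₁ - T₂` would vanish at `u₁`, where
`Tₖ = φₖ(·) uₖ`. -/
theorem coeff_mul_coeff_ne_one (h₁ : IsHermitianOperator (φ₁.smulRight u₁))
    (h₂ : IsHermitianOperator (φ₂.smulRight u₂)) (e₁ : φ₁ u₁ = 1) (e₂ : φ₂ u₂ = 1)
    (hu : LinearIndependent ℂ ![u₁, u₂]) : φ₁ u₂ * φ₂ u₁ ≠ 1 := by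
  intro hc
  rw [LinearIndependent.pair_iff] at hu
  have := (h₁.sub h₂).apply_eq_zero (x := u₁) (by
    simp only [_root_.sub_apply, ContinuousLinearMap.smulRight_apply, map_sub,
      map_smul, e₁, e₂]
    have : (1 : ℂ) • ((1 : ℂ) • u₁ - φ₂ u₁ • u₂) - φ₂ u₁ • (φ₁ u₂ • u₁ - (1 : ℂ) • u₂)
        = (1 - φ₁ u₂ * φ₂ u₁) • u₁ := by
      module
    rw [this, hc, sub_self, zero_smul])
  simp only [_root_.sub_apply, ContinuousLinearMap.smulRight_apply, e₁] at this
  refine one_ne_zero (hu 1 (-φ₂ u₁) ?_).1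
  rw [← this]
  module

/-- Conjugating `T₂ = φ₂(·) u₂` by the isometries `1 + (λ - 1) T₁`, where `T₁ = φ₁(·) u₁`, and
removing real multiples of `T₁` and `T₂` shows that `z T₁ T₂ + conj z T₂ T₁` is hermitian for
`z = λ - 1`. The values for `λ = -1` and `λ = i` span `ℂ` over `ℝ`. -/
theorem isHermitianOperator_mixed (h₁ : IsHermitianOperator (φ₁.smulRight u₁))
    (h₂ : IsHermitianOperator (φ₂.smulRight u₂)) (e₁ : φ₁ u₁ = 1)
    {c : ℝ} (hc : φ₁ u₂ * φ₂ u₁ = c) (z : ℂ) :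
    IsHermitianOperator (φ₂.smulRight ((z * φ₁ u₂) • u₁) + φ₁.smulRight ((conj z * φ₂ u₁) • u₂)) := by
  have key : ∀ l : ℂ, ‖l‖ = 1 → IsHermitianOperator
      (φ₂.smulRight (((l - 1) * φ₁ u₂) • u₁) + φ₁.smulRight ((conj (l - 1) * φ₂ u₁) • u₂)) := by
    intro l hl
    have hconj := h₂.conj_projection h₁ (by simp [e₁]) hl
    have := (hconj.sub h₂).sub (h₁.real_smul (Complex.normSq (l - 1) * c))
    convert this using 1
    ext x
    simp only [_root_.sub_apply, ContinuousLinearMap.smulRight_apply,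
      _root_.add_apply, _root_.smul_apply, ContinuousLinearMap.comp_apply,
      ContinuousLinearMap.id_apply, map_add, map_smul]
    push_cast
    rw [← Complex.mul_conj, ← hc, map_sub, map_one]
    module
  have hneg := (key (-1) (by simp)).real_smul (-(z.re + z.im) / 2)
  have hI := (key Complex.I (by simp)).real_smul z.im
  convert hneg.add hI using 1
  ext x
  simp only [ContinuousLinearMap.smulRight_apply,
      _root_.add_apply, _root_.smul_apply, map_sub, map_neg, map_one,
      Complex.conj_I]
  have hz1 : z = -(z.re + z.im) / 2 * (-1 - 1) + z.im * (Complex.I - 1) := by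
    conv_lhs => rw [← Complex.re_add_im z]
    ring
  have hz2 : conj z = -(z.re + z.im) / 2 * (-1 - 1) + z.im * (-Complex.I - 1) := by
    conv_lhs => rw [← Complex.re_add_im z]
    rw [map_add, map_mul, Complex.conj_ofReal, Complex.conj_ofReal, Complex.conj_I]
    ring
  rw [hz2]
  conv_lhs => enter [1, 2, 1, 1]; rw [hz1]
  push_cast
  module

/-- If two rank one hermitian projections with independent ranges are not mutually orthogonal,
then the plane spanned by their ranges consists of hermitian elements. With
`r = φ₂ u₁ / conj (φ₁ u₂) > 0`, the plane carries a hermitian inner product for which the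
functional `conj α • φ₁ + r⁻¹ * conj β • φ₂` represents `α • u₁ + β • u₂`; the corresponding rank one
operators are hermitian. -/
theorem isHermitianElement_of_pair (h₁ : IsHermitianOperator (φ₁.smulRight u₁))
    (h₂ : IsHermitianOperator (φ₂.smulRight u₂)) (e₁ : φ₁ u₁ = 1) (e₂ : φ₂ u₂ = 1)
    (hu : LinearIndependent ℂ ![u₁, u₂]) (hg : φ₁ u₂ ≠ 0) (α β : ℂ) :
    IsHermitianElement (α • u₁ + β • u₂) := by
  obtain ⟨c, hc0, hc⟩ := coeff_mul_coeff_pos h₁ h₂ e₁ e₂ hu hg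
  have hc1 := coeff_mul_coeff_ne_one h₁ h₂ e₁ e₂ hu
  by_cases hαβ : α = 0 ∧ β = 0
  · rw [hαβ.1, hαβ.2]; simpa using isHermitianElement_zero
  set g := φ₁ u₂ with hgdef
  set h := φ₂ u₁ with hhdef
  obtain ⟨r, hr0, hr⟩ : ∃ r : ℝ, 0 < r ∧ h = r * conj g := by
    have hn : 0 < Complex.normSq g := Complex.normSq_pos.2 hg
    refine ⟨c / Complex.normSq g, by positivity, ?_⟩
    have hgc : conj g ≠ 0 := by simpa using hg
    apply mul_left_cancel₀ hg
    rw [hc]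
    push_cast
    rw [← Complex.mul_conj]
    field_simp
  have hrC : (r : ℂ) ≠ 0 := by exact_mod_cast hr0.ne'
  have hgc : conj g ≠ 0 := by simpa using hg
  have hu' := LinearIndependent.pair_iff.1 hu
  have hop : IsHermitianOperator
      ((conj α • φ₁ + ((r : ℂ)⁻¹ * conj β) • φ₂).smulRight (α • u₁ + β • u₂)) := by
    have hm := isHermitianOperator_mixed h₁ h₂ e₁ hc ((r : ℂ)⁻¹ * α * conj β / g)
    have hd := (h₁.real_smul (Complex.normSq α)).add (h₂.real_smul (r⁻¹ * Complex.normSq β))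
    convert hd.add hm using 1
    have s1 : (r : ℂ)⁻¹ * α * conj β / g * g = (r : ℂ)⁻¹ * α * conj β := by field_simp
    have s2 : conj ((r : ℂ)⁻¹ * α * conj β / g) * h = conj α * β := by
      rw [hr]; simp; field_simp
    rw [← hgdef, ← hhdef, s1, s2]
    ext x
    simp only [ContinuousLinearMap.smulRight_apply,
      _root_.add_apply, _root_.smul_apply, smul_eq_mul]
    push_cast
    rw [← Complex.mul_conj, ← Complex.mul_conj]
    module
  refine hop.isHermitianElement (hop.coeff_ne_zero (fun h0 => hαβ ?_) fun h0 => hαβ (hu' _ _ h0))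
  -- The functional is nonzero: its values at `u₁` and `u₂` determine `α` and `β` since `g * h ≠ 1`.
  have q1 := congrArg (fun f : StrongDual ℂ E => f u₁) h0
  have q2 := congrArg (fun f : StrongDual ℂ E => f u₂) h0
  simp only [_root_.add_apply, _root_.smul_apply, smul_eq_mul, e₁, e₂,
    ← hgdef, ← hhdef, _root_.zero_apply] at q1 q2
  have hβ : (r : ℂ)⁻¹ * conj β * (1 - g * h) = 0 := by linear_combination q2 - g * q1
  have hβ0 : β = 0 := by
    have := (mul_eq_zero.1 hβ).resolve_right (sub_ne_zero.2 (Ne.symm hc1))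
    simpa [hrC] using this
  refine ⟨?_, hβ0⟩
  simpa [hβ0] using q1

/-- Every subspace of hermitian elements is contained in a Hilbert component. -/
theorem exists_isHilbertComponent_ge {K : Submodule ℂ E} (hK : (K : Set E) ⊆ hermitianElements E) :
    ∃ H, K ≤ H ∧ IsHilbertComponent H := by
  obtain ⟨H, hKH, hH⟩ := zorn_le_nonempty₀ {L : Submodule ℂ E | (L : Set E) ⊆ hermitianElements E}
    (fun C hC hchain L hL => ⟨sSup C, fun x hx => by
      obtain ⟨M, hM, hxM⟩ := (Submodule.mem_sSup_of_directed ⟨L, hL⟩ hchain.directedOn).1 hx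
      exact hC hM hxM, fun M hM => le_sSup hM⟩) K hK
  exact ⟨H, hKH, hH⟩

theorem HasNoNontrivialHilbertComponent.not_linearIndependent
    (hE : HasNoNontrivialHilbertComponent E)
    (h : ∀ α β : ℂ, IsHermitianElement (α • u₁ + β • u₂)) :
    ¬ LinearIndependent ℂ ![u₁, u₂] := by
  intro hu
  obtain ⟨H, hKH, hH⟩ := exists_isHilbertComponent_ge (K := Submodule.span ℂ {u₁, u₂}) (by
    intro x hx
    obtain ⟨α, β, rfl⟩ := Submodule.mem_span_pair.1 hx
    exact h α β)
  refine hE H hH ?_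
  have hrank : Module.rank ℂ (Submodule.span ℂ (Set.range ![u₁, u₂])) = 2 := by
    have h2 := Cardinal.mk_range_eq_of_injective hu.injective
    rw [rank_span hu]
    simpa using h2
  have hle : Module.rank ℂ (Submodule.span ℂ (Set.range ![u₁, u₂])) ≤ Module.rank ℂ H := by
    refine Submodule.rank_mono ?_
    rwa [Matrix.range_cons_cons_empty]
  refine lt_of_lt_of_le ?_ hle
  rw [hrank]
  exact Cardinal.one_lt_two

/-- Without nontrivial Hilbert components, two rank one hermitian operators are either
orthogonal or have the same range. -/
theorem HasNoNontrivialHilbertComponent.smul_eq_smul (hE : HasNoNontrivialHilbertComponent E)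
    (h₁ : IsHermitianOperator (φ₁.smulRight u₁)) (h₂ : IsHermitianOperator (φ₂.smulRight u₂))
    (e₁ : φ₁ u₁ ≠ 0) (e₂ : φ₂ u₂ ≠ 0) (hg : φ₁ u₂ ≠ 0) :
    φ₁ u₁ • u₂ = φ₁ u₂ • u₁ := by
  have hdep : ¬ LinearIndependent ℂ ![u₁, u₂] := fun hu =>
    hE.not_linearIndependent (isHermitianElement_of_pair h₁.normalize h₂.normalize
      (by simp [e₁]) (by simp [e₂]) hu (by simp [hg, e₁])) hu
  have hu₁ : u₁ ≠ 0 := by rintro rfl; simp at e₁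
  rw [LinearIndependent.pair_iff' hu₁] at hdep
  push Not at hdep
  obtain ⟨a, rfl⟩ := hdep
  simp only [map_smul, smul_eq_mul]
  module

end HermitianElements

/-! ### Coordinates with respect to a `1`-unconditional basis -/

section Basis

variable {ι X : Type*} [NormedAddCommGroup X] [NormedSpace ℂ X]
  {b : UnconditionalSchauderBasis ι ℂ X}

theorem ext_coord {x y : X} (h : ∀ i, b.coord i x = b.coord i y) : x = y := by
  have hy := b.expansion y
  simp only [← h] at hy
  exact (b.expansion x).unique hy

theorem coord_basis_self (i : ι) : b.coord i (b i) = 1 := by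
  classical
  simp [b.ortho]

theorem coord_basis_of_ne {i j : ι} (h : j ≠ i) : b.coord j (b i) = 0 := by
  classical
  simp [b.ortho, h]

theorem coord_of_hasSum {a : ι → ℂ} {x : X} (h : HasSum (fun i => a i • b i) x) (i : ι) :
    b.coord i x = a i := by
  classical
  have h1 := h.mapL (b.coord i)
  refine h1.unique ?_
  have he : (fun j => b.coord i (a j • b j)) = fun j => if j = i then a i else 0 := ?_
  · rw [he]; exact hasSum_ite_eq i (a i)
  funext j
  by_cases hij : j = i
  · subst hij; simp [coord_basis_self]
  · simp [coord_basis_of_ne (Ne.symm hij), hij]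

namespace IsNormalizedOneUnconditional

variable (hb : IsNormalizedOneUnconditional b)
include hb

theorem norm_sum_eq_of_norm_eq {a c : ι → ℂ} (h : ∀ i, ‖a i‖ = ‖c i‖) (s : Finset ι) :
    ‖∑ i ∈ s, a i • b i‖ = ‖∑ i ∈ s, c i • b i‖ := by
  classical
  have := hb.norm_sum_eq s c (fun i => if c i = 0 then 1 else a i / c i) (fun i => by
    by_cases hi : c i = 0
    · simp [hi]
    · simp [hi, h])
  rw [← this]
  congr 1
  refine Finset.sum_congr rfl fun i _ => ?_
  by_cases hi : c i = 0
  · have : a i = 0 := by simpa [hi] using h i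
    simp [hi, this]
  · simp [hi]

theorem norm_eq_of_norm_coord_eq {x y : X} (h : ∀ i, ‖b.coord i x‖ = ‖b.coord i y‖) :
    ‖x‖ = ‖y‖ := by
  refine tendsto_nhds_unique (b.expansion x).norm ?_
  refine (b.expansion y).norm.congr fun s => ?_
  exact (hb.norm_sum_eq_of_norm_eq h s).symm

theorem exists_coord_eq [CompleteSpace X] (x : X) {a : ι → ℂ} (h : ∀ i, ‖a i‖ = ‖b.coord i x‖) :
    ∃ y : X, ∀ i, b.coord i y = a i := by
  have hs : Summable fun i => a i • b i := by
    rw [summable_iff_vanishing_norm]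
    intro ε hε
    obtain ⟨s, hs⟩ := summable_iff_vanishing_norm.1 (b.expansion x).summable ε hε
    refine ⟨s, fun t ht => ?_⟩
    rw [hb.norm_sum_eq_of_norm_eq h]
    exact hs t ht
  exact ⟨_, coord_of_hasSum hs.hasSum⟩

/-- Removing a nonzero coordinate strictly decreases the norm: by `1`-unconditionality the
coordinates may be replaced by their absolute values. -/
theorem norm_sub_lt [CompleteSpace X] (hmono : IsStrictlyMonotone b) {x : X} {i : ι}
    (hi : b.coord i x ≠ 0) : ‖x - b.coord i x • b i‖ < ‖x‖ := by
  obtain ⟨y, hy⟩ := hb.exists_coord_eq (x - b.coord i x • b i)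
    (a := fun j => (‖b.coord j (x - b.coord i x • b i)‖ : ℂ)) (by simp)
  have hself : b.coord i (x - b.coord i x • b i) = 0 := by simp [coord_basis_self]
  have hne : ∀ j, j ≠ i → b.coord j (x - b.coord i x • b i) = b.coord j x := by
    intro j hj; simp [coord_basis_of_ne hj]
  have h1 : ‖y‖ = ‖x - b.coord i x • b i‖ := hb.norm_eq_of_norm_coord_eq (by simp [hy])
  have h2 : ‖y + (‖b.coord i x‖ : ℂ) • b i‖ = ‖x‖ := by
    refine hb.norm_eq_of_norm_coord_eq fun j => ?_
    by_cases hj : j = i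
    · subst hj
      rw [map_add, hy, hself]
      simp [coord_basis_self]
    · rw [map_add, hy, hne j hj]
      simp [coord_basis_of_ne hj]
  rw [← h1, ← h2]
  refine hmono _ _ (fun j => ?_) (fun j => ?_) fun h0 => ?_
  · rw [hy]; simp
  · by_cases hj : j = i
    · subst hj; simp [coord_basis_self]
    · simp [coord_basis_of_ne hj]
  · have := congrArg (b.coord i) h0
    simp [coord_basis_self, hi] at this

/-- The coordinate projection `x ↦ xᵢ eᵢ` generates the isometries that rotate the `i`-th
coordinate, hence is hermitian. -/
theorem isHermitianOperator_coord (i : ι) :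
    IsHermitianOperator ((b.coord i).smulRight (b i)) := by
  intro x f hf
  set w := f ((b.coord i).smulRight (b i) x) with hw
  have key : ∀ t : ℝ, (Real.cos t - 1) * w.re - Real.sin t * w.im ≤ 0 := by
    intro t
    set l : ℂ := Complex.exp (t * Complex.I) with hl
    have hl1 : ‖l‖ = 1 := Complex.norm_exp_ofReal_mul_I t
    have hn : ‖x + (l - 1) • (b.coord i).smulRight (b i) x‖ = ‖x‖ := by
      refine hb.norm_eq_of_norm_coord_eq fun j => ?_
      by_cases hj : j = i
      · subst hj
        have : b.coord j x + (l - 1) * b.coord j x = l * b.coord j x := by ring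
        simp [coord_basis_self, this, hl1]
      · simp [coord_basis_of_ne hj]
    have h1 := (Complex.re_le_norm _).trans (f.le_opNorm (x + (l - 1) • (b.coord i).smulRight (b i) x))
    rw [hn, hf.1, one_mul, map_add, map_smul, hf.2, ← hw] at h1
    have hre : l.re = Real.cos t := by rw [hl]; exact Complex.exp_ofReal_mul_I_re t
    have him : l.im = Real.sin t := by rw [hl]; exact Complex.exp_ofReal_mul_I_im t
    simp [hre, him] at h1
    linarith
  -- The left side of `key` has a maximum at `t = 0`; its derivative there is `-w.im`.
  have hmax : IsLocalMax (fun t : ℝ => (Real.cos t - 1) * w.re - Real.sin t * w.im) 0 :=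
    Filter.Eventually.of_forall fun t => by simpa using key t
  have hd : HasDerivAt (fun t : ℝ => (Real.cos t - 1) * w.re - Real.sin t * w.im)
      ((-Real.sin 0) * w.re - Real.cos 0 * w.im) 0 :=
    (((Real.hasDerivAt_cos 0).sub_const 1).mul_const _).sub ((Real.hasDerivAt_sin 0).mul_const _)
  have := hmax.hasDerivAt_eq_zero hd
  simpa using this

end IsNormalizedOneUnconditional

theorem hasSum_map (L : StrongDual ℂ X) (x : X) :
    HasSum (fun i => b.coord i x * L (b i)) (L x) := by
  simpa using (b.expansion x).mapL L

end Basis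

/-! ### Norm one projections -/

section Projection

variable {ι X : Type*} [NormedAddCommGroup X] [NormedSpace ℂ X]
  {b : UnconditionalSchauderBasis ι ℂ X} {P : X →L[ℂ] X} {Y : Submodule ℂ X}

/-- The compression to `Y` of the hermitian operator `x ↦ xᵢ eᵢ` is hermitian: composing a norming
functional on `Y` with the projection gives a norming functional on `X`. -/
theorem isHermitianOperator_compression (hb : IsNormalizedOneUnconditional b)
    (hPnorm : ‖P‖ ≤ 1) (hPY : ∀ x, P x ∈ Y) (hPid : ∀ y ∈ Y, P y = y) (i : ι) :
    IsHermitianOperator (((b.coord i).comp Y.subtypeL).smulRight (⟨P (b i), hPY _⟩ : Y)) := by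
  intro y f hf
  have h := (hb.isHermitianOperator_coord i).im_eq_zero (x := (y : X))
    (f := f ∘L P.codRestrict Y hPY) ?_ ?_
  · rw [ContinuousLinearMap.smulRight_apply, map_smul] at h ⊢
    exact h
  · refine ContinuousLinearMap.opNorm_le_bound _ zero_le_one fun x => ?_
    refine (f.le_of_opNorm_le hf.1.le _).trans ?_
    have := P.le_of_opNorm_le hPnorm x
    simpa using this
  · have he : (P.codRestrict Y hPY) y = y := Subtype.ext (hPid y y.2)
    rw [ContinuousLinearMap.comp_apply, he, hf.2]
    simp

open Classical in
/-- The functionals that cut out `Y`, indexed by pairs `(i, j)`: the coordinate `xᵢ` if it vanishes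
on `Y`, and otherwise the relation `(P eᵢ)ⱼ xᵢ = (P eᵢ)ᵢ xⱼ` if `(P eᵢ)ⱼ ≠ 0`. -/
noncomputable def cuttingFunctional (b : UnconditionalSchauderBasis ι ℂ X) (P : X →L[ℂ] X)
    (Y : Submodule ℂ X) (p : ι × ι) : StrongDual ℂ X :=
  if ∀ y ∈ Y, b.coord p.1 y = 0 then b.coord p.1
  else if b.coord p.2 (P (b p.1)) = 0 then 0
  else b.coord p.2 (P (b p.1)) • b.coord p.1 - b.coord p.1 (P (b p.1)) • b.coord p.2

theorem encard_functionalSupport_cuttingFunctional_le (p : ι × ι) :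
    (functionalSupport b (cuttingFunctional b P Y p)).encard ≤ 2 := by
  have hsub : functionalSupport b (cuttingFunctional b P Y p) ⊆ {p.1, p.2} := by
    intro k hk
    by_contra hne
    simp only [Set.mem_insert_iff, Set.mem_singleton_iff, not_or] at hne
    refine hk ?_
    unfold cuttingFunctional
    split_ifs <;> simp [coord_basis_of_ne (Ne.symm hne.1), coord_basis_of_ne (Ne.symm hne.2)]
  exact (Set.encard_le_encard hsub).trans (Set.encard_insert_le _ _ |>.trans (by
    rw [Set.encard_singleton]; norm_num))

variable [CompleteSpace X]

/-- If a coordinate functional does not vanish on `Y`, then it does not vanish at the image of its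
basis vector. Strict monotonicity excludes `P eᵢ = 0`, as `P` would then map `y - yᵢ eᵢ` to the
vector `y` of larger norm. -/
theorem coord_proj_basis_ne_zero (hb : IsNormalizedOneUnconditional b)
    (hmono : IsStrictlyMonotone b)
    (hPnorm : ‖P‖ ≤ 1) (hPY : ∀ x, P x ∈ Y) (hPid : ∀ y ∈ Y, P y = y) {i : ι} {y : X}
    (hy : y ∈ Y) (hyi : b.coord i y ≠ 0) : b.coord i (P (b i)) ≠ 0 := by
  refine (isHermitianOperator_compression hb hPnorm hPY hPid i).coeff_ne_zero
    (fun h0 => hyi ?_) fun h0 => ?_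
  · exact congrArg (fun f : StrongDual ℂ Y => f ⟨y, hy⟩) h0
  · have hPi : P (b i) = 0 := congrArg Subtype.val h0
    have h1 := hb.norm_sub_lt hmono hyi
    have h2 := P.le_of_opNorm_le hPnorm (y - b.coord i y • b i)
    rw [map_sub, map_smul, hPi, smul_zero, sub_zero, hPid y hy] at h2
    linarith

/-- If `(P eⱼ)ᵢ ≠ 0` and the `j`-th coordinate functional does not vanish on `Y`, then `P eᵢ` and `P eⱼ`
are proportional: otherwise they would span a plane of hermitian elements. -/
theorem smul_proj_basis_eq (hb : IsNormalizedOneUnconditional b)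
    (hmono : IsStrictlyMonotone b) (hcomp : HasNoNontrivialHilbertComponent Y)
    (hPnorm : ‖P‖ ≤ 1) (hPY : ∀ x, P x ∈ Y) (hPid : ∀ y ∈ Y, P y = y) {i j : ι} {y : X}
    (hy : y ∈ Y) (hyj : b.coord j y ≠ 0) (hij : b.coord i (P (b j)) ≠ 0) :
    b.coord i (P (b i)) • P (b j) = b.coord i (P (b j)) • P (b i) := by
  have h := hcomp.smul_eq_smul (isHermitianOperator_compression hb hPnorm hPY hPid i)
    (isHermitianOperator_compression hb hPnorm hPY hPid j)
    (coord_proj_basis_ne_zero hb hmono hPnorm hPY hPid (hPY _) hij)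
    (coord_proj_basis_ne_zero hb hmono hPnorm hPY hPid hy hyj) hij
  exact congrArg Subtype.val h

/-- If `yᵢ` does not vanish identically on `Y` and `(P eᵢ)ⱼ ≠ 0`, then the coordinates `yᵢ` and `yⱼ`
of `y ∈ Y` are proportional to those of `P eᵢ`. -/
theorem coord_mul_coord_eq (hb : IsNormalizedOneUnconditional b)
    (hmono : IsStrictlyMonotone b) (hcomp : HasNoNontrivialHilbertComponent Y)
    (hPnorm : ‖P‖ ≤ 1) (hPY : ∀ x, P x ∈ Y) (hPid : ∀ y ∈ Y, P y = y) {i j : ι} {y₀ : X}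
    (hy₀ : y₀ ∈ Y) (hyi : b.coord i y₀ ≠ 0) (hij : b.coord j (P (b i)) ≠ 0) {y : X} (hy : y ∈ Y) :
    b.coord j (P (b i)) * b.coord i y = b.coord i (P (b i)) * b.coord j y := by
  have hii := coord_proj_basis_ne_zero hb hmono hPnorm hPY hPid hy₀ hyi
  have hjj := coord_proj_basis_ne_zero hb hmono hPnorm hPY hPid (hPY _) hij
  set G : StrongDual ℂ X :=
    b.coord j (P (b i)) • b.coord i - b.coord i (P (b i)) • b.coord j with hG
  have hGi : G (P (b i)) = 0 := by simp [hG]; ring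
  have hGj : G (P (b j)) = 0 := by
    have := congrArg G (smul_proj_basis_eq hb hmono hcomp hPnorm hPY hPid hy₀ hyi hij)
    simpa [hGi, hij] using this.symm
  suffices G y = 0 by simpa [hG, sub_eq_zero] using this
  have hsum := hasSum_map (b := b) (G ∘L P) y
  rw [ContinuousLinearMap.comp_apply, hPid y hy] at hsum
  refine hsum.unique ?_
  convert hasSum_zero using 2 with k
  rcases eq_or_ne (b.coord k y) 0 with hk | hk
  · simp [hk]
  · rw [ContinuousLinearMap.comp_apply]
    refine mul_eq_zero_of_right _ ?_
    by_cases hki : b.coord i (P (b k)) = 0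
    · by_cases hkj : b.coord j (P (b k)) = 0
      · simp [hG, hki, hkj]
      · have := congrArg G (smul_proj_basis_eq hb hmono hcomp hPnorm hPY hPid hy hk hkj)
        simpa [hGj, hjj] using this
    · have := congrArg G (smul_proj_basis_eq hb hmono hcomp hPnorm hPY hPid hy hk hki)
      simpa [hGi, hii] using this

theorem cuttingFunctional_apply_eq_zero (hb : IsNormalizedOneUnconditional b)
    (hmono : IsStrictlyMonotone b) (hcomp : HasNoNontrivialHilbertComponent Y)
    (hPnorm : ‖P‖ ≤ 1) (hPY : ∀ x, P x ∈ Y) (hPid : ∀ y ∈ Y, P y = y) (p : ι × ι) {y : X}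
    (hy : y ∈ Y) : cuttingFunctional b P Y p y = 0 := by
  unfold cuttingFunctional
  split_ifs with h1 h2
  · exact h1 y hy
  · simp
  · push Not at h1
    obtain ⟨y₀, hy₀, h1⟩ := h1
    simp [coord_mul_coord_eq hb hmono hcomp hPnorm hPY hPid hy₀ h1 h2 hy]

/-- If `x` satisfies the relations, then the coordinate `(P x)ⱼ` depends on `xⱼ` alone and is
proportional to it; evaluation at `P eⱼ` shows that the factor is `1`. -/
theorem mem_of_cuttingFunctional_eq_zero (hb : IsNormalizedOneUnconditional b)
    (hmono : IsStrictlyMonotone b) (hcomp : HasNoNontrivialHilbertComponent Y)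
    (hPnorm : ‖P‖ ≤ 1) (hPY : ∀ x, P x ∈ Y) (hPid : ∀ y ∈ Y, P y = y) {x : X}
    (hx : ∀ p, cuttingFunctional b P Y p x = 0) : x ∈ Y := by
  classical
  suffices P x = x by rw [← this]; exact hPY x
  refine ext_coord (b := b) fun j => ?_
  by_cases hj : ∀ y ∈ Y, b.coord j y = 0
  · have := hx (j, j)
    simp only [cuttingFunctional, if_pos hj] at this
    rw [this, hj _ (hPY x)]
  push Not at hj
  obtain ⟨y₀, hy₀, hj⟩ := hj
  have hjj := coord_proj_basis_ne_zero hb hmono hPnorm hPY hPid hy₀ hj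
  set w : ι → ℂ := fun i =>
    if (∀ y ∈ Y, b.coord i y = 0) ∨ b.coord j (P (b i)) = 0 then 0 else b.coord i (P (b i)) with hw
  have hterm : ∀ z : X, (∀ p, cuttingFunctional b P Y p z = 0) →
      HasSum (fun i => b.coord j z * w i) (b.coord j (P z)) := by
    intro z hz
    have hsum := hasSum_map (b := b) (b.coord j ∘L P) z
    rw [ContinuousLinearMap.comp_apply] at hsum
    convert hsum using 2 with i
    have hzi := hz (i, j)
    simp only [hw, cuttingFunctional, ContinuousLinearMap.comp_apply] at hzi ⊢
    by_cases h1 : ∀ y ∈ Y, b.coord i y = 0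
    · rw [if_pos h1] at hzi
      rw [if_pos (Or.inl h1), hzi, mul_zero, zero_mul]
    · by_cases h2 : b.coord j (P (b i)) = 0
      · simp [h2]
      · rw [if_neg h1, if_neg h2] at hzi
        rw [if_neg (not_or.2 ⟨h1, h2⟩)]
        simp only [_root_.sub_apply, _root_.smul_apply,
          smul_eq_mul] at hzi
        linear_combination -hzi
  have hcut : ∀ p, cuttingFunctional b P Y p (P (b j)) = 0 := fun p =>
    cuttingFunctional_apply_eq_zero hb hmono hcomp hPnorm hPY hPid p (hPY _)
  have hone : HasSum w 1 := by
    have h := (hterm _ hcut).mul_left (b.coord j (P (b j)))⁻¹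
    rw [hPid _ (hPY _), inv_mul_cancel₀ hjj] at h
    simpa [← mul_assoc, hjj] using h
  refine (hterm x hx).unique ?_
  simpa using hone.mul_left (b.coord j x)

end Projection

end OneComplemented

theorem corollary3p3 {ι : Type*} [Countable ι] {X : Type*} [NormedAddCommGroup X]
    [NormedSpace ℂ X] [CompleteSpace X] (b : UnconditionalSchauderBasis ι ℂ X)
    (hb : OneComplemented.IsNormalizedOneUnconditional b)
    (hmono : OneComplemented.IsStrictlyMonotone b)
    (P : X →L[ℂ] X) (hP : P ∘L P = P) (hPnorm : ‖P‖ = 1)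
    (Y : Submodule ℂ X) (hY : Y = (P : X →ₗ[ℂ] X).range)
    (hcomp : OneComplemented.HasNoNontrivialHilbertComponent Y) :
    ∃ (J : Type) (_ : Countable J) (f : J → StrongDual ℂ X),
      (∀ j, (OneComplemented.functionalSupport b (f j)).encard ≤ 2) ∧
      Y = ⨅ j, (f j : X →ₗ[ℂ] ℂ).ker := by
  have hPY : ∀ x, P x ∈ Y := fun x => hY ▸ ⟨x, rfl⟩
  have hPid : ∀ y ∈ Y, P y = y := by
    intro y hy
    rw [hY] at hy
    obtain ⟨x, rfl⟩ := hy
    exact congrArg (fun T : X →L[ℂ] X => T x) hP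
  -- The index type has to lie in the lowest universe.
  refine ⟨Shrink.{0} (ι × ι), (equivShrink.{0} (ι × ι)).symm.injective.countable,
    fun j => OneComplemented.cuttingFunctional b P Y ((equivShrink.{0} (ι × ι)).symm j),
    fun j => OneComplemented.encard_functionalSupport_cuttingFunctional_le _, ?_⟩
  ext x
  simp only [Submodule.mem_iInf, LinearMap.mem_ker, ContinuousLinearMap.coe_coe]
  constructor
  · intro hx j
    exact OneComplemented.cuttingFunctional_apply_eq_zero hb hmono hcomp hPnorm.le hPY hPid _ hx
  · intro hx
    refine OneComplemented.mem_of_cuttingFunctional_eq_zero hb hmono hcomp hPnorm.le hPY hPid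
      fun p => ?_
    simpa using hx (equivShrink.{0} (ι × ι) p)
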